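/- Let $n \ge 1$ and $\lambda = (n,n)$, the Young diagram with two rows of length $n$. A row-standard filling of a Young diagram with $N$ boxes and no repeated entries places each of $1,\dots,N$ in exactly one box so that the entries increase from left to right along each row; the columns are not required to increase. Let $i<j$ be two entries in the same column of a row-standard filling $\tau$, and let $i_k$, $j_k$ denote the entries $k$ boxes to the right of $i$, $j$. The pair $(i,j)$ is an inversion pair of $\tau$ if, for some $m\ge 0$, the entries $i_k$ and $j_k$ exist and $i_k=j_k$ for all $1\le k\le m$, and either (a) $i_{m+1}$ or $j_{m+1}$ does not exist and $i$ appears below $j$, or (b) $i_{m+1}$ and $j_{m+1}$ both exist and $i_{m+1}>j_{m+1}$ (when there are no repeated entries only $m=0$ can occur). Let $S_k(\lambda)$ be the set of $k$-inverted standard Young tableaux of shape $\lambda$, that is, of row-standard fillings of $\lambda$ without repeated entries that have exactly $k$ inversion pairs. For integers $\alpha,\beta\ge 0$ let $B(\alpha,\beta)=\frac{\alpha-\beta+1}{\alpha+1}\binom{\alpha+\beta}{\alpha}$ be the ballot number. Then $$\sum_{k\ge 0} |S_k(\lambda)|\, q^k \;=\; \sum_{i=1}^{n} B(n-1,n-i)\,(1+q)^i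 \;=\; \sum_{i=1}^{n} \frac{i}{n}\binom{2n-i-1}{n-i}(1+q)^i .$$ Moreover, for $0\le i\le n$, $B(n-1,n-i)$ is the number of Dyck paths from $(0,0)$ to $(n,n)$ (lattice paths with steps $(1,0)$ and $(0,1)$ all of whose points $(x,y)$ satisfy $y\le x$) that have exactly $i$ returns to ground, i.e. that contain exactly $i$ points $(x,x)$ with $x>0$. -/

import Mathlib

/-- A row-standard filling of the Young diagram `μ` (cell `(i, j)` is in row `i`, column `j`):
positive integers in the cells, no integer being skipped, strictly increasing along each row.
As for Mathlib's `SemistandardYoungTableau`, the filling is a function on `ℕ × ℕ` that is `0`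
outside `μ`. -/
@[ext]
structure RowStandardFilling (μ : YoungDiagram) where
  entry : ℕ → ℕ → ℕ
  zeros : ∀ {i j : ℕ}, (i, j) ∉ μ → entry i j = 0
  pos : ∀ {i j : ℕ}, (i, j) ∈ μ → 1 ≤ entry i j
  no_skip : ∀ {i j v : ℕ}, (i, j) ∈ μ → 1 ≤ v → v ≤ entry i j →
    ∃ c ∈ μ, entry c.1 c.2 = v
  row_strict : ∀ {i j₁ j₂ : ℕ}, j₁ < j₂ → (i, j₂) ∈ μ → entry i j₁ < entry i j₂

namespace RowStandardFilling

variable {μ : YoungDiagram}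

/-- The entries of `τ` in the cells `(r, c)` and `(s, c)` of column `c` form an inversion pair
`(entry r c, entry s c)`: the first entry is the smaller one, the entries in the `n` cells to the
right of both cells exist and agree, and then either one of the two next cells to the right does
not exist and the smaller entry stands below the larger one (rows are numbered downwards), or both
next cells exist and the one to the right of the smaller entry contains the larger value. -/
def IsInversionPair (τ : RowStandardFilling μ) (r s c : ℕ) : Prop :=
  (r, c) ∈ μ ∧ (s, c) ∈ μ ∧ τ.entry r c < τ.entry s c ∧
    ∃ n : ℕ,
      (∀ k, 1 ≤ k → k ≤ n →
        (r, c + k) ∈ μ ∧ (s, c + k) ∈ μ ∧ τ.entry r (c + k) = τ.entry s (c + k)) ∧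
      ((((r, c + (n + 1)) ∉ μ ∨ (s, c + (n + 1)) ∉ μ) ∧ s < r) ∨
        ((r, c + (n + 1)) ∈ μ ∧ (s, c + (n + 1)) ∈ μ ∧
          τ.entry s (c + (n + 1)) < τ.entry r (c + (n + 1))))

/-- The number of inversion pairs of `τ`, where equal pairs of values in different
cells are counted separately. -/
noncomputable def inv (τ : RowStandardFilling μ) : ℕ :=
  {p : ℕ × ℕ × ℕ | τ.IsInversionPair p.1 p.2.1 p.2.2}.ncard

/-- No value is repeated. As no value is skipped, the entries are then `1, 2, …, N` with `N` the
number of cells. -/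
def NoRepeats (τ : RowStandardFilling μ) : Prop :=
  Set.InjOn (fun c : ℕ × ℕ => τ.entry c.1 c.2) {c | c ∈ μ}

theorem entry_le_card (τ : RowStandardFilling μ) (i j : ℕ) : τ.entry i j ≤ μ.card := by
  by_cases h : (i, j) ∈ μ
  · have hsub : Finset.Icc 1 (τ.entry i j) ⊆ μ.cells.image (fun c => τ.entry c.1 c.2) := by
      intro v hv
      rw [Finset.mem_Icc] at hv
      obtain ⟨c, hc, hcv⟩ := τ.no_skip h hv.1 hv.2
      exact Finset.mem_image.2 ⟨c, hc, hcv⟩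
    have h1 := (Finset.card_le_card hsub).trans Finset.card_image_le
    simpa using h1
  · simp [τ.zeros h]

/-- A Young diagram has only finitely many row-standard fillings. -/
instance finite : Finite (RowStandardFilling μ) := by
  refine Finite.of_injective
    (fun τ (c : μ.cells) =>
      (⟨τ.entry c.1.1 c.1.2, Nat.lt_succ_of_le (τ.entry_le_card _ _)⟩ : Fin (μ.card + 1))) ?_
  intro τ τ' h
  ext i j
  by_cases hij : (i, j) ∈ μ
  · have := congrFun h ⟨(i, j), hij⟩
    simpa using this
  · rw [τ.zeros hij, τ'.zeros hij]

/-- A filling has only finitely many inversion pairs. -/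
theorem finite_inversionPairs (τ : RowStandardFilling μ) :
    {p : ℕ × ℕ × ℕ | τ.IsInversionPair p.1 p.2.1 p.2.2}.Finite := by
  refine Set.Finite.of_finite_image (f := fun p => ((p.1, p.2.2), (p.2.1, p.2.2)))
    (((μ.cells ×ˢ μ.cells).finite_toSet).subset ?_) ?_
  · rintro _ ⟨p, hp, rfl⟩
    simpa using ⟨hp.1, hp.2.1⟩
  · rintro ⟨a, b, c⟩ _ ⟨a', b', c'⟩ _ h
    simp only [Prod.mk.injEq] at h ⊢
    tauto

end RowStandardFilling

/-- The set `S_k(μ)` of `k`-inverted standard Young tableaux of shape `μ`. -/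
def invertedStandardTableaux (k : ℕ) (μ : YoungDiagram) : Set (RowStandardFilling μ) :=
  {τ | τ.NoRepeats ∧ τ.inv = k}

/-- The shape `(n, n)`: two rows of length `n`. -/
def twoRowShape (n : ℕ) : YoungDiagram :=
  YoungDiagram.ofRowLens [n, n] (List.Pairwise.sortedGE (by simp))

theorem mem_twoRowShape {n i j : ℕ} : (i, j) ∈ twoRowShape n ↔ i < 2 ∧ j < n := by
  rw [twoRowShape, YoungDiagram.mem_ofRowLens]
  constructor
  · rintro ⟨h, hj⟩
    have h2 : i < 2 := by simpa using h
    interval_cases i <;> simpa using hj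
  · rintro ⟨h, hj⟩
    interval_cases i <;> simpa using hj

/-- The ballot number `B(α, β) = (α - β + 1) / (α + 1) * binom(α + β, α)`. -/
def ballotNumber (α β : ℕ) : ℚ :=
  ((α : ℚ) - β + 1) / (α + 1) * (α + β).choose α

/-- The number of returns to ground of a Dyck path: the number of vertices other than the starting
point that lie on the ground line. Up-steps `U` play the role of east steps `(1, 0)`, and down-steps
`D` that of north steps `(0, 1)`, so these are the vertices `(x, x)` with `x > 0`. -/
def DyckWord.returnsToGround (p : DyckWord) : ℕ :=
  ((Finset.Icc 1 p.toList.length).filter fun i =>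
    (p.toList.take i).count DyckStep.U = (p.toList.take i).count DyckStep.D).card

/-- The Dyck paths from `(0, 0)` to `(n, n)` with exactly `k` returns to ground. -/
def dyckPathsWithReturns (n k : ℕ) : Set DyckWord :=
  {p | p.semilength = n ∧ p.returnsToGround = k}

/-! Both counts solve one weighted ballot recurrence: E(a, b) obeys Pascal's rule below the
diagonal, and E(b+1, b+1) = t · E(b+1, b). Its solution is a sum of ballot numbers times powers of t
(`eq_sum_ballotNumber`). For Dyck prefixes, delete the last step: a diagonal endpoint forces a last
step `D` and is itself a return, so t = q. For fillings with rows of lengths a and b, delete the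
largest entry, which ends one of the rows. Without a column condition either row may hold it. A
column is inverted when its order differs from that of the next column, and the last column is
compared with a fictitious "first < second" column, as if the missing cell of the second row held
infinity. Thus while the second row stays the shorter one or has just received the maximum, deletion
preserves the statistic (`rowInv_appendLeft`, `rowInv_appendRight`). For equal lengths with the
maximum in the first row, deletion followed by swapping the rows loses exactly one inversion
(`rowInv_appendLeft_diag`). Both cases lead to shape (b+1, b), so t = 1 + q. -/

/-! ### Ballot numbers and the weighted recurrence -/

theorem ballotNumber_zero_right (α : ℕ) : ballotNumber α 0 = 1 := by
  have : (α : ℚ) + 1 ≠ 0 := by positivity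
  simp [ballotNumber, this]

theorem ballotNumber_self_succ (α : ℕ) : ballotNumber α (α + 1) = 0 := by
  simp [ballotNumber]

/-- Pascal's rule (`h1`) leaves two binomials, whose ratio is fixed by the absorption identity `h2`.
-/
theorem ballotNumber_succ_succ (α β : ℕ) :
    ballotNumber (α + 1) (β + 1) = ballotNumber α (β + 1) + ballotNumber (α + 1) β := by
  have h1 : ((α + 1 + (β + 1)).choose (α + 1) : ℚ) =
      (α + (β + 1)).choose α + (α + 1 + β).choose (α + 1) := by
    rw [show α + 1 + (β + 1) = (α + 1 + β) + 1 by ring, Nat.choose_succ_succ,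
      show α + (β + 1) = α + 1 + β by ring]
    push_cast; ring
  have h2 : ((α + 1 + β).choose (α + 1) : ℚ) * (α + 1) = (α + (β + 1)).choose α * (β + 1) := by
    have := Nat.choose_succ_right_eq (α + 1 + β) α
    rw [show α + 1 + β - α = β + 1 by omega] at this
    rw [show α + (β + 1) = α + 1 + β by ring]
    exact_mod_cast this
  simp only [ballotNumber]
  rw [h1]
  set x : ℚ := ((α + 1 + β).choose (α + 1) : ℚ)
  set y : ℚ := ((α + (β + 1)).choose α : ℚ)
  have ha : (α : ℚ) + 1 ≠ 0 := by positivity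
  have ha' : (α : ℚ) + 1 + 1 ≠ 0 := by positivity
  push_cast
  field_simp
  linear_combination (-1 : ℚ) * h2

theorem ballotNumber_pred_sub (n i : ℕ) (hi : 1 ≤ i) (hin : i ≤ n) :
    ballotNumber (n - 1) (n - i) = (i : ℚ) / n * (2 * n - i - 1).choose (n - i) := by
  obtain ⟨m, rfl⟩ : ∃ m, n = m + 1 := ⟨n - 1, by omega⟩
  obtain ⟨d, hd⟩ : ∃ d, d = m + 1 - i := ⟨_, rfl⟩
  have h : m + 1 = d + i := by omega
  have hq : (m : ℚ) + 1 = d + i := by exact_mod_cast h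
  rw [← hd, show 2 * (m + 1) - i - 1 = m + d by omega, ballotNumber, Nat.add_sub_cancel,
    Nat.choose_symm_add]
  push_cast
  congr 2
  linear_combination hq

/-- The ballot recurrence with a weight `t` on each return to the diagonal. -/
theorem eq_sum_ballotNumber {R : Type*} [CommRing R] [Algebra ℚ R] (t : R) (E : ℕ → ℕ → R)
    (h_zero : E 0 0 = 1) (h_right : ∀ a, E (a + 1) 0 = E a 0)
    (h_step : ∀ a b, b + 1 ≤ a → E (a + 1) (b + 1) = E a (b + 1) + E (a + 1) b)
    (h_diag : ∀ b, E (b + 1) (b + 1) = t * E (b + 1) b) (a b : ℕ) (hab : b ≤ a + 1) :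
    E (a + 1) b = ∑ i ∈ Finset.range (b + 1), ballotNumber a (b - i) • t ^ i := by
  induction a generalizing b with
  | zero =>
    have h10 : E 1 0 = 1 := by rw [h_right, h_zero]
    interval_cases b
    · simp [h10, ballotNumber_zero_right]
    · rw [h_diag, Finset.sum_range_succ]
      simp [h10, ballotNumber_zero_right, ballotNumber_self_succ 0]
  | succ a iha =>
    induction b with
    | zero =>
      rw [h_right, iha 0 (by omega)]
      simp [ballotNumber_zero_right]
    | succ b ihb =>
      rcases Nat.lt_or_ge (a + 1) (b + 1) with h | h
      -- On the diagonal the `i = 0` term is B(a+1, a+2) = 0; the remaining terms are t times the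
      -- previous sum after an index shift.
      · obtain rfl : b = a + 1 := by omega
        rw [h_diag, ihb (by omega), Finset.sum_range_succ' _ (a + 1 + 1), Finset.mul_sum]
        simp only [Nat.sub_zero, ballotNumber_self_succ, zero_smul, add_zero]
        refine Finset.sum_congr rfl fun i _ => ?_
        rw [mul_smul_comm, ← pow_succ', Nat.add_sub_add_right]
      -- The top power `b + 1` occurs only in E(a+1, b+1), with coefficient B(a, 0) = 1 = B(a+1, 0);
      -- the lower powers combine by the ballot recurrence.
      · rw [h_step _ _ h, iha _ h, ihb (by omega), Finset.sum_range_succ _ (b + 1),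
          Finset.sum_range_succ _ (b + 1), add_right_comm, ← Finset.sum_add_distrib]
        simp only [Nat.sub_self, ballotNumber_zero_right]
        congr 1
        refine Finset.sum_congr rfl fun i hi => ?_
        rw [Finset.mem_range] at hi
        rw [show b + 1 - i = b - i + 1 by omega, ballotNumber_succ_succ, add_smul]

theorem sum_range_ballotNumber_pred {R : Type*} [CommRing R] [Algebra ℚ R] (t : R) (n : ℕ)
    (hn : 1 ≤ n) :
    ∑ i ∈ Finset.range (n + 1), ballotNumber (n - 1) (n - i) • t ^ i =
      ∑ i ∈ Finset.Icc 1 n, ballotNumber (n - 1) (n - i) • t ^ i := by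
  obtain ⟨m, rfl⟩ : ∃ m, n = m + 1 := ⟨n - 1, by omega⟩
  rw [Finset.range_eq_Ico, Finset.sum_eq_sum_Ico_succ_bot (by omega)]
  simp only [Nat.add_sub_cancel, Nat.sub_zero, ballotNumber_self_succ, zero_smul, zero_add]
  rfl

/-- The power series counting a finite set by a statistic. -/
theorem PowerSeries.mk_card_filter {ι : Type*} (s : Finset ι) (f : ι → ℕ) :
    (PowerSeries.mk fun k => ((s.filter fun x => f x = k).card : ℚ)) =
      ∑ x ∈ s, (PowerSeries.X : PowerSeries ℚ) ^ f x := by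
  ext k
  simp [PowerSeries.coeff_X_pow, Finset.sum_boole, eq_comm]

/-! ### Dyck prefixes counted by returns -/

namespace DyckStep

theorem count_U_add_count_D (l : List DyckStep) : l.count U + l.count D = l.length := by
  induction l with
  | nil => rfl
  | cons s l ih => cases s <;> simp <;> omega

instance : Finite DyckStep :=
  Finite.of_injective (fun s => decide (s = U)) (by rintro (_ | _) (_ | _) <;> simp)

end DyckStep

open DyckStep in
/-- The lattice paths from `(0, 0)` to `(a, b)` that stay weakly below the diagonal. -/
def IsDyckPrefix (a b : ℕ) (l : List DyckStep) : Prop :=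
  l.count U = a ∧ l.count D = b ∧ ∀ i, (l.take i).count D ≤ (l.take i).count U

/-- The number of vertices of a lattice path, other than its starting point, on the diagonal. -/
def List.returns (l : List DyckStep) : ℕ :=
  ((Finset.Icc 1 l.length).filter fun i =>
    (l.take i).count DyckStep.U = (l.take i).count DyckStep.D).card

open DyckStep

theorem List.returns_concat (l : List DyckStep) (s : DyckStep) :
    (l ++ [s]).returns = l.returns + if (l ++ [s]).count U = (l ++ [s]).count D then 1 else 0 := by
  have hIcc : Finset.Icc 1 (l ++ [s]).length = insert (l.length + 1) (Finset.Icc 1 l.length) := by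
    ext i; simp; omega
  have hfilter : ((Finset.Icc 1 l.length).filter fun i =>
      ((l ++ [s]).take i).count U = ((l ++ [s]).take i).count D) =
      (Finset.Icc 1 l.length).filter fun i => (l.take i).count U = (l.take i).count D := by
    refine Finset.filter_congr fun i hi => ?_
    rw [List.take_append_of_le_length (Finset.mem_Icc.1 hi).2]
  have htake : (l ++ [s]).take (l.length + 1) = l ++ [s] := List.take_of_length_le (by simp)
  rw [List.returns, hIcc, Finset.filter_insert, hfilter, htake]
  split_ifs with h
  · rw [Finset.card_insert_of_notMem (by simp), List.returns]
  · rfl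

theorem isDyckPrefix_nil {a b : ℕ} : IsDyckPrefix a b [] ↔ a = 0 ∧ b = 0 := by
  simp [IsDyckPrefix, eq_comm]

theorem forall_take_concat (l : List DyckStep) (s : DyckStep) :
    (∀ i, ((l ++ [s]).take i).count D ≤ ((l ++ [s]).take i).count U) ↔
      (∀ i, (l.take i).count D ≤ (l.take i).count U) ∧
        (l ++ [s]).count D ≤ (l ++ [s]).count U := by
  constructor
  · refine fun h => ⟨fun i => ?_, ?_⟩
    · rcases le_total i l.length with hi | hi
      · simpa [List.take_append_of_le_length hi] using h i
      · simpa [List.take_of_length_le hi] using h l.length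
    · have h' := h (l.length + 1)
      rwa [List.take_of_length_le (by simp)] at h'
  · rintro ⟨h, h'⟩ i
    rcases le_or_gt i l.length with hi | hi
    · simpa [List.take_append_of_le_length hi] using h i
    · rw [List.take_of_length_le (by simpa using hi)]
      exact h'

theorem isDyckPrefix_concat_U {a b : ℕ} {l : List DyckStep} :
    IsDyckPrefix a b (l ++ [U]) ↔ 1 ≤ a ∧ IsDyckPrefix (a - 1) b l := by
  have h := fun h : ∀ i, (l.take i).count D ≤ (l.take i).count U => h l.length
  simp only [List.take_length] at h
  simp only [IsDyckPrefix, forall_take_concat]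
  simp
  grind

theorem isDyckPrefix_concat_D {a b : ℕ} {l : List DyckStep} :
    IsDyckPrefix a b (l ++ [D]) ↔ 1 ≤ b ∧ b ≤ a ∧ IsDyckPrefix a (b - 1) l := by
  simp only [IsDyckPrefix, forall_take_concat]
  simp
  grind

theorem finite_isDyckPrefix (a b : ℕ) : {l | IsDyckPrefix a b l}.Finite := by
  refine (List.finite_length_eq DyckStep (a + b)).subset ?_
  rintro l ⟨ha, hb, -⟩
  simp [← count_U_add_count_D, ha, hb]

/-- The finite set of lattice paths from `(0, 0)` to `(a, b)` that stay weakly below the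
diagonal. -/
noncomputable def dyckPrefixes (a b : ℕ) : Finset (List DyckStep) :=
  (finite_isDyckPrefix a b).toFinset

theorem mem_dyckPrefixes {a b : ℕ} {l : List DyckStep} :
    l ∈ dyckPrefixes a b ↔ IsDyckPrefix a b l := by
  simp [dyckPrefixes]

theorem mem_image_concat {s : Finset (List DyckStep)} {x y : DyckStep} {l : List DyckStep} :
    l ++ [x] ∈ s.image (· ++ [y]) ↔ x = y ∧ l ∈ s := by
  simp only [Finset.mem_image, List.append_singleton_inj]
  grind

theorem dyckPrefixes_zero_zero : dyckPrefixes 0 0 = {[]} := by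
  ext l
  rcases List.eq_nil_or_concat l with rfl | ⟨l, s, rfl⟩
  · simp [mem_dyckPrefixes, isDyckPrefix_nil]
  · cases s <;> simp [mem_dyckPrefixes, isDyckPrefix_concat_U, isDyckPrefix_concat_D]

theorem dyckPrefixes_succ_zero (a : ℕ) :
    dyckPrefixes (a + 1) 0 = (dyckPrefixes a 0).image (· ++ [U]) := by
  ext l
  rcases List.eq_nil_or_concat l with rfl | ⟨l, s, rfl⟩
  · simp [mem_dyckPrefixes, isDyckPrefix_nil]
  · rw [List.concat_eq_append, mem_image_concat]
    cases s <;> simp [mem_dyckPrefixes, isDyckPrefix_concat_U, isDyckPrefix_concat_D]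

/-- Classification by the last step; `hab` is what makes a final `D` legal. -/
theorem dyckPrefixes_succ_succ (a b : ℕ) (hab : b ≤ a) :
    dyckPrefixes (a + 1) (b + 1) =
      (dyckPrefixes a (b + 1)).image (· ++ [U]) ∪ (dyckPrefixes (a + 1) b).image (· ++ [D]) := by
  ext l
  rcases List.eq_nil_or_concat l with rfl | ⟨l, s, rfl⟩
  · simp [mem_dyckPrefixes, isDyckPrefix_nil]
  · rw [List.concat_eq_append, Finset.mem_union, mem_image_concat, mem_image_concat]
    cases s <;> simp [mem_dyckPrefixes, isDyckPrefix_concat_U, isDyckPrefix_concat_D, hab]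

theorem dyckPrefixes_self_succ (a : ℕ) : dyckPrefixes a (a + 1) = ∅ := by
  refine Finset.eq_empty_of_forall_notMem fun l hl => ?_
  obtain ⟨h1, h2, h3⟩ := mem_dyckPrefixes.1 hl
  have := h3 l.length
  rw [List.take_length] at this
  omega

theorem dyckPrefixes_succ_self (a : ℕ) :
    dyckPrefixes (a + 1) (a + 1) = (dyckPrefixes (a + 1) a).image (· ++ [D]) := by
  rw [dyckPrefixes_succ_succ a a le_rfl, dyckPrefixes_self_succ, Finset.image_empty,
    Finset.empty_union]

/-- All extended paths share one endpoint, so the new vertex adds the same `c` to each: 1 on the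
diagonal, 0 off it. -/
theorem sum_image_concat {a b : ℕ} {R : Type*} [CommRing R] (t : R) (s : DyckStep) (c : ℕ)
    (h : ∀ l ∈ dyckPrefixes a b,
      (if (l ++ [s]).count U = (l ++ [s]).count D then 1 else 0) = c) :
    ∑ l ∈ (dyckPrefixes a b).image (· ++ [s]), t ^ l.returns =
      t ^ c * ∑ l ∈ dyckPrefixes a b, t ^ l.returns := by
  rw [Finset.sum_image fun l _ l' _ h => List.append_cancel_right h, Finset.mul_sum]
  refine Finset.sum_congr rfl fun l hl => ?_
  rw [List.returns_concat, h l hl, pow_add, mul_comm]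

theorem sum_dyckPrefixes {R : Type*} [CommRing R] [Algebra ℚ R] (t : R) (a b : ℕ)
    (hab : b ≤ a + 1) :
    ∑ l ∈ dyckPrefixes (a + 1) b, t ^ l.returns =
      ∑ i ∈ Finset.range (b + 1), ballotNumber a (b - i) • t ^ i := by
  refine eq_sum_ballotNumber t (fun a b => ∑ l ∈ dyckPrefixes a b, t ^ l.returns)
    ?_ (fun a => ?_) (fun a b h => ?_) (fun b => ?_) a b hab
  · simp [dyckPrefixes_zero_zero, List.returns]
  · rw [dyckPrefixes_succ_zero, sum_image_concat t U 0, pow_zero, one_mul]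
    intro l hl
    obtain ⟨h1, h2, -⟩ := mem_dyckPrefixes.1 hl
    simp [h1, h2]
  · rw [dyckPrefixes_succ_succ a b (by omega), Finset.sum_union, sum_image_concat t U 0,
      sum_image_concat t D 0, pow_zero, one_mul, one_mul]
    · intro l hl
      obtain ⟨h1, h2, -⟩ := mem_dyckPrefixes.1 hl
      simp [h1, h2]; omega
    · intro l hl
      obtain ⟨h1, h2, -⟩ := mem_dyckPrefixes.1 hl
      simp [h1, h2]; omega
    · rw [Finset.disjoint_left]
      simp only [Finset.mem_image]
      rintro _ ⟨l, -, rfl⟩ ⟨l', -, h⟩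
      simp at h
  · rw [dyckPrefixes_succ_self, sum_image_concat t D 1, pow_one]
    intro l hl
    obtain ⟨h1, h2, -⟩ := mem_dyckPrefixes.1 hl
    simp [h1, h2]

theorem DyckWord.semilength_eq_iff (p : DyckWord) (n : ℕ) :
    p.semilength = n ↔ IsDyckPrefix n n p.toList := by
  have h := p.count_U_eq_count_D
  have h' := p.count_D_le_count_U
  simp only [DyckWord.semilength, IsDyckPrefix]
  grind

theorem ncard_dyckPathsWithReturns_eq_card (n k : ℕ) :
    (dyckPathsWithReturns n k).ncard = ((dyckPrefixes n n).filter fun l => l.returns = k).card := by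
  rw [← Set.ncard_coe_finset]
  refine Set.ncard_congr (fun p _ => p.toList) ?_ (fun p q _ _ => DyckWord.ext) ?_
  · rintro p ⟨hp, hk⟩
    -- `hk` fits because `DyckWord.returnsToGround` is by definition `List.returns` of the
    -- underlying list.
    exact Finset.mem_coe.2 (Finset.mem_filter.2
      ⟨mem_dyckPrefixes.2 ((p.semilength_eq_iff n).1 hp), hk⟩)
  · intro l hl
    simp only [Finset.coe_filter, mem_dyckPrefixes, Set.mem_ofPred_eq] at hl
    exact ⟨⟨l, hl.1.1.trans hl.1.2.1.symm, hl.1.2.2⟩, ⟨hl.1.1, hl.2⟩, rfl⟩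

theorem ncard_dyckPathsWithReturns (n i : ℕ) (hn : 1 ≤ n) (hi : i ≤ n) :
    ((dyckPathsWithReturns n i).ncard : ℚ) = ballotNumber (n - 1) (n - i) := by
  obtain ⟨m, rfl⟩ : ∃ m, n = m + 1 := ⟨n - 1, by omega⟩
  have h := (PowerSeries.mk_card_filter (dyckPrefixes (m + 1) (m + 1)) List.returns).trans
    (sum_dyckPrefixes PowerSeries.X m (m + 1) le_rfl)
  have h' := congrArg (PowerSeries.coeff i) h
  rw [ncard_dyckPathsWithReturns_eq_card]
  simpa [PowerSeries.coeff_X_pow, Nat.lt_succ_iff.2 hi] using h'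

/-! ### Two-row fillings and removal of the largest entry -/

/-- The functions `f` and `g` list the entries of two rows of lengths `a` and `b`, padded by zeros:
the rows increase strictly and together they contain each of `1, …, a + b` once. -/
structure IsTwoRowFilling (a b : ℕ) (f g : ℕ → ℕ) : Prop where
  left_zero : ∀ j, a ≤ j → f j = 0
  right_zero : ∀ j, b ≤ j → g j = 0
  left_mem : ∀ j < a, 1 ≤ f j ∧ f j ≤ a + b
  right_mem : ∀ j < b, 1 ≤ g j ∧ g j ≤ a + b
  left_lt : ∀ i j, i < j → j < a → f i < f j
  right_lt : ∀ i j, i < j → j < b → g i < g j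
  ne : ∀ i j, i < a → j < b → f i ≠ g j

namespace IsTwoRowFilling

variable {a b : ℕ} {f g : ℕ → ℕ}

theorem swap (h : IsTwoRowFilling a b f g) : IsTwoRowFilling b a g f where
  left_zero := h.right_zero
  right_zero := h.left_zero
  left_mem := by simpa [add_comm] using h.right_mem
  right_mem := by simpa [add_comm] using h.left_mem
  left_lt := h.right_lt
  right_lt := h.left_lt
  ne i j hi hj := (h.ne j i hj hi).symm

theorem injOn_left (h : IsTwoRowFilling a b f g) : Set.InjOn f (Finset.range a) := by
  intro i hi j hj hij
  simp only [Finset.coe_range, Set.mem_Iio] at hi hj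
  rcases lt_trichotomy i j with hlt | heq | hlt
  · exact absurd hij (h.left_lt i j hlt hj).ne
  · exact heq
  · exact absurd hij (h.left_lt j i hlt hi).ne'

/-- Pigeonhole: the `a + b` entries are distinct and lie in an interval with `a + b` elements. -/
theorem exists_eq (h : IsTwoRowFilling a b f g) {v : ℕ} (hv : 1 ≤ v) (hv' : v ≤ a + b) :
    (∃ j < a, f j = v) ∨ ∃ j < b, g j = v := by
  have hsub : (Finset.range a).image f ∪ (Finset.range b).image g ⊆ Finset.Icc 1 (a + b) := by
    intro x hx
    simp only [Finset.mem_union, Finset.mem_image, Finset.mem_range] at hx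
    rw [Finset.mem_Icc]
    rcases hx with ⟨j, hj, rfl⟩ | ⟨j, hj, rfl⟩
    · exact h.left_mem j hj
    · exact h.right_mem j hj
  have hdisj : Disjoint ((Finset.range a).image f) ((Finset.range b).image g) := by
    rw [Finset.disjoint_left]
    simp only [Finset.mem_image, Finset.mem_range]
    rintro _ ⟨i, hi, rfl⟩ ⟨j, hj, hij⟩
    exact h.ne i j hi hj hij.symm
  have heq := Finset.eq_of_subset_of_card_le hsub (by
    rw [Finset.card_union_of_disjoint hdisj, Finset.card_image_of_injOn h.injOn_left,
      Finset.card_image_of_injOn h.swap.injOn_left]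
    simp)
  have hmem : v ∈ (Finset.range a).image f ∪ (Finset.range b).image g := by
    rw [heq]; exact Finset.mem_Icc.2 ⟨hv, hv'⟩
  simpa using hmem

theorem update_left (h : IsTwoRowFilling a b f g) :
    IsTwoRowFilling (a + 1) b (Function.update f a (a + b + 1)) g where
  left_zero j hj := by
    have := h.left_zero j
    rw [Function.update_apply]
    split_ifs <;> omega
  right_zero := h.right_zero
  left_mem j hj := by
    have := h.left_mem j
    rw [Function.update_apply]
    split_ifs <;> omega
  right_mem j hj := by
    have := h.right_mem j
    omega
  left_lt i j hij hj := by
    have := h.left_mem i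
    have := h.left_lt i j
    rw [Function.update_apply, Function.update_apply]
    split_ifs <;> omega
  right_lt := h.right_lt
  ne i j hi hj := by
    have := h.right_mem j hj
    have := h.ne i j
    rw [Function.update_apply]
    split_ifs <;> omega

theorem update_right (h : IsTwoRowFilling a b f g) :
    IsTwoRowFilling a (b + 1) f (Function.update g b (a + b + 1)) := by
  simpa only [add_comm a b] using h.swap.update_left.swap

theorem erase_left (h : IsTwoRowFilling (a + 1) b f g) (hf : f a = a + b + 1) :
    IsTwoRowFilling a b (Function.update f a 0) g := by
  have hlt : ∀ j < a, f j < a + b + 1 := fun j hj => hf ▸ h.left_lt j a hj (by omega)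
  have hlt' : ∀ j < b, g j < a + b + 1 := fun j hj => by
    have := h.ne a j (by omega) hj
    have := (h.right_mem j hj).2
    omega
  exact
    { left_zero := fun j hj => by
        have := h.left_zero j
        rw [Function.update_apply]
        split_ifs <;> omega
      right_zero := h.right_zero
      left_mem := fun j hj => by
        have := h.left_mem j
        have := hlt j
        rw [Function.update_apply]
        split_ifs <;> omega
      right_mem := fun j hj => by
        have := h.right_mem j
        have := hlt' j
        omega
      left_lt := fun i j hij hj => by
        have := h.left_lt i j
        rw [Function.update_apply, Function.update_apply]
        split_ifs <;> omega
      right_lt := h.right_lt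
      ne := fun i j hi hj => by
        have := h.ne i j
        rw [Function.update_apply]
        split_ifs <;> omega }

theorem left_last (h : IsTwoRowFilling (a + 1) b f g) {j : ℕ} (hj : j < a + 1)
    (hf : f j = a + 1 + b) : f a = a + b + 1 := by
  rcases Nat.lt_or_ge j a with hja | hja
  · have h1 := h.left_lt j a hja (by omega)
    have h2 := (h.left_mem a (by omega)).2
    omega
  · obtain rfl : j = a := by omega
    omega

end IsTwoRowFilling

theorem isTwoRowFilling_zero_zero {f g : ℕ → ℕ} :
    IsTwoRowFilling 0 0 f g ↔ f = 0 ∧ g = 0 := by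
  constructor
  · exact fun h => ⟨funext fun j => h.left_zero j j.zero_le, funext fun j => h.right_zero j j.zero_le⟩
  · rintro ⟨rfl, rfl⟩
    constructor <;> simp

/-- Appending the entry `v` in column `c` to the first row. -/
def appendLeft (c v : ℕ) (p : (ℕ → ℕ) × (ℕ → ℕ)) : (ℕ → ℕ) × (ℕ → ℕ) :=
  (Function.update p.1 c v, p.2)

/-- Appending the entry `v` in column `c` to the second row. -/
def appendRight (c v : ℕ) (p : (ℕ → ℕ) × (ℕ → ℕ)) : (ℕ → ℕ) × (ℕ → ℕ) :=
  (p.1, Function.update p.2 c v)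

/-- The set of two-row fillings, as pairs of rows. -/
def twoRowFillingSet (a b : ℕ) : Set ((ℕ → ℕ) × (ℕ → ℕ)) := {p | IsTwoRowFilling a b p.1 p.2}

theorem twoRowFillingSet_zero_zero : twoRowFillingSet 0 0 = {0} := by
  ext ⟨f, g⟩
  simp [twoRowFillingSet, isTwoRowFilling_zero_zero, Prod.ext_iff]

theorem swap_image_twoRowFillingSet (a b : ℕ) :
    Prod.swap '' twoRowFillingSet a b = twoRowFillingSet b a := by
  ext ⟨f, g⟩
  rw [Set.image_swap_eq_preimage_swap]
  exact ⟨IsTwoRowFilling.swap, IsTwoRowFilling.swap⟩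

theorem mem_image_appendLeft {a b : ℕ} {f g : ℕ → ℕ} (h : IsTwoRowFilling (a + 1) b f g)
    (hf : f a = a + b + 1) : (f, g) ∈ appendLeft a (a + b + 1) '' twoRowFillingSet a b :=
  ⟨(Function.update f a 0, g), h.erase_left hf, by simp [appendLeft, ← hf]⟩

theorem mem_image_appendRight {a b : ℕ} {f g : ℕ → ℕ} (h : IsTwoRowFilling a (b + 1) f g)
    (hg : g b = a + b + 1) : (f, g) ∈ appendRight b (a + b + 1) '' twoRowFillingSet a b :=
  ⟨(f, Function.update g b 0), (h.swap.erase_left (by omega)).swap, by simp [appendRight, ← hg]⟩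

theorem image_appendLeft_subset (a b : ℕ) :
    appendLeft a (a + b + 1) '' twoRowFillingSet a b ⊆ twoRowFillingSet (a + 1) b := by
  rintro _ ⟨p, hp, rfl⟩
  exact IsTwoRowFilling.update_left hp

theorem image_appendRight_subset (a b : ℕ) :
    appendRight b (a + b + 1) '' twoRowFillingSet a b ⊆ twoRowFillingSet a (b + 1) := by
  rintro _ ⟨p, hp, rfl⟩
  exact IsTwoRowFilling.update_right hp

theorem twoRowFillingSet_succ_zero (a : ℕ) :
    twoRowFillingSet (a + 1) 0 = appendLeft a (a + 0 + 1) '' twoRowFillingSet a 0 := by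
  refine Set.Subset.antisymm ?_ (image_appendLeft_subset a 0)
  rintro ⟨f, g⟩ (h : IsTwoRowFilling _ _ f g)
  rcases h.exists_eq (v := a + 1 + 0) (by omega) le_rfl with ⟨j, hj, hf⟩ | ⟨j, hj, -⟩
  · exact mem_image_appendLeft h (h.left_last hj hf)
  · omega

/-- The maximum ends one of the rows. With no column condition, both removals are reversible for all
`a` and `b`. -/
theorem twoRowFillingSet_succ_succ (a b : ℕ) :
    twoRowFillingSet (a + 1) (b + 1) =
      appendLeft a (a + (b + 1) + 1) '' twoRowFillingSet a (b + 1) ∪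
        appendRight b (a + 1 + b + 1) '' twoRowFillingSet (a + 1) b := by
  refine Set.Subset.antisymm ?_
    (Set.union_subset (image_appendLeft_subset a (b + 1)) (image_appendRight_subset (a + 1) b))
  rintro ⟨f, g⟩ (h : IsTwoRowFilling _ _ f g)
  rcases h.exists_eq (v := a + 1 + (b + 1)) (by omega) le_rfl with ⟨j, hj, hf⟩ | ⟨j, hj, hg⟩
  · exact Or.inl (mem_image_appendLeft h (h.left_last hj hf))
  · have := h.swap.left_last hj (by omega)
    exact Or.inr (mem_image_appendRight h (by omega))

theorem finite_twoRowFillingSet (a b : ℕ) : (twoRowFillingSet a b).Finite := by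
  induction a generalizing b with
  | zero =>
    induction b with
    | zero => simp [twoRowFillingSet_zero_zero]
    | succ b ih =>
      rw [← swap_image_twoRowFillingSet, twoRowFillingSet_succ_zero,
        ← swap_image_twoRowFillingSet 0 b]
      exact ((ih.image _).image _).image _
  | succ a iha =>
    induction b with
    | zero =>
      rw [twoRowFillingSet_succ_zero]
      exact (iha 0).image _
    | succ b ihb =>
      rw [twoRowFillingSet_succ_succ]
      exact ((iha _).image _).union (ihb.image _)

theorem disjoint_image_append (a b : ℕ) :
    Disjoint (appendLeft a (a + (b + 1) + 1) '' twoRowFillingSet a (b + 1))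
      (appendRight b (a + 1 + b + 1) '' twoRowFillingSet (a + 1) b) := by
  rw [Set.disjoint_left]
  rintro _ ⟨p, hp, rfl⟩ ⟨p', hp', h⟩
  have h1 : p'.1 a = a + (b + 1) + 1 := by
    simpa [appendLeft, appendRight] using congrFun (congrArg Prod.fst h) a
  have h2 := (IsTwoRowFilling.left_mem hp' a (by omega)).2
  omega

theorem injOn_appendLeft (a b v : ℕ) : Set.InjOn (appendLeft a v) (twoRowFillingSet a b) := by
  rintro ⟨f, g⟩ (hp : IsTwoRowFilling _ _ f g) ⟨f', g'⟩ (hp' : IsTwoRowFilling _ _ f' g') h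
  simp only [appendLeft, Prod.mk.injEq] at h ⊢
  refine ⟨funext fun j => ?_, h.2⟩
  by_cases hj : j = a
  · rw [hj, hp.left_zero a le_rfl, hp'.left_zero a le_rfl]
  · simpa [hj] using congrFun h.1 j

theorem injOn_appendRight (a b v : ℕ) : Set.InjOn (appendRight b v) (twoRowFillingSet a b) := by
  rintro ⟨f, g⟩ (hp : IsTwoRowFilling _ _ f g) ⟨f', g'⟩ (hp' : IsTwoRowFilling _ _ f' g') h
  simp only [appendRight, Prod.mk.injEq] at h ⊢
  refine ⟨h.1, funext fun j => ?_⟩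
  by_cases hj : j = b
  · rw [hj, hp.right_zero b le_rfl, hp'.right_zero b le_rfl]
  · simpa [hj] using congrFun h.2 j

/-! ### The inversion statistic under removal of the largest entry -/

/-- The number of inversion pairs of a pair of rows, the second of which has length `b` and the
first of which is at least as long: a column contributes when its order differs from the order of
the next column, or, for the last column, when its smaller entry is in the second row. -/
def rowInv (b : ℕ) (p : (ℕ → ℕ) × (ℕ → ℕ)) : ℕ :=
  ((Finset.range b).filter fun c =>
    ¬(p.1 c < p.2 c ↔ (c + 1 < b → p.1 (c + 1) < p.2 (c + 1)))).card

/-- The statistic reads only columns below `b`, and the new cell is in column `a`. -/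
theorem rowInv_appendLeft {a b : ℕ} (v : ℕ) (hab : b ≤ a) (p : (ℕ → ℕ) × (ℕ → ℕ)) :
    rowInv b (appendLeft a v p) = rowInv b p := by
  unfold rowInv appendLeft
  congr 1
  refine Finset.filter_congr fun c hc => ?_
  rw [Finset.mem_range] at hc
  simp only [Function.update_apply]
  grind

/-- The new column `b` has its maximum in the second row, so it is not inverted. Column `b - 1` now
sees a genuine "first < second" neighbour in place of the fictitious one. -/
theorem rowInv_appendRight {a b : ℕ} {p : (ℕ → ℕ) × (ℕ → ℕ)} (hp : p ∈ twoRowFillingSet a b)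
    (hab : b + 1 ≤ a) : rowInv (b + 1) (appendRight b (a + b + 1) p) = rowInv b p := by
  have hb := (IsTwoRowFilling.left_mem hp b (by omega)).2
  unfold rowInv appendRight
  rw [Finset.range_add_one, Finset.filter_insert, if_neg]
  · congr 1
    refine Finset.filter_congr fun c hc => ?_
    rw [Finset.mem_range] at hc
    simp only [Function.update_apply]
    grind
  · simp; omega

/-- The last column has its smaller entry in the second row, hence the `+ 1`. Elsewhere the swap
reverses both orders being compared; for column `b - 1` it turns the "first > second" neighbour into
the fictitious one. -/
theorem rowInv_appendLeft_diag {b : ℕ} {p : (ℕ → ℕ) × (ℕ → ℕ)}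
    (hp : p ∈ twoRowFillingSet b (b + 1)) :
    rowInv (b + 1) (appendLeft b (b + (b + 1) + 1) p) = rowInv b p.swap + 1 := by
  have hb := (IsTwoRowFilling.right_mem hp b (by omega)).2
  have hne := IsTwoRowFilling.ne hp
  unfold rowInv appendLeft
  rw [Finset.range_add_one, Finset.filter_insert, if_pos, Finset.card_insert_of_notMem (by simp)]
  · congr 2
    refine Finset.filter_congr fun c hc => ?_
    rw [Finset.mem_range] at hc
    have h1 := hne c c hc (by omega)
    have h2 := hne (c + 1) (c + 1)
    simp only [Function.update_apply, Prod.fst_swap, Prod.snd_swap]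
    grind
  · simp; omega

/-- The sum over all two-row fillings of `t` to the number of inversion pairs. -/
noncomputable def rowInvSum {R : Type*} [CommRing R] (t : R) (a b : ℕ) : R :=
  ∑ᶠ p ∈ twoRowFillingSet a b, t ^ rowInv b p

theorem rowInvSum_eq {R : Type*} [CommRing R] [Algebra ℚ R] (t : R) (a b : ℕ) (hab : b ≤ a + 1) :
    rowInvSum t (a + 1) b =
      ∑ i ∈ Finset.range (b + 1), ballotNumber a (b - i) • (1 + t) ^ i := by
  refine eq_sum_ballotNumber (1 + t) (rowInvSum t)
    ?_ (fun a => ?_) (fun a b h => ?_) (fun b => ?_) a b hab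
  · rw [rowInvSum, twoRowFillingSet_zero_zero, finsum_mem_singleton]
    simp [rowInv]
  · rw [rowInvSum, rowInvSum, twoRowFillingSet_succ_zero,
      finsum_mem_image (injOn_appendLeft a 0 _)]
    exact finsum_mem_congr rfl fun p _ => by rw [rowInv_appendLeft _ (Nat.zero_le a)]
  · rw [rowInvSum, rowInvSum, rowInvSum, twoRowFillingSet_succ_succ,
      finsum_mem_union (disjoint_image_append a b) ((finite_twoRowFillingSet _ _).image _)
        ((finite_twoRowFillingSet _ _).image _),
      finsum_mem_image (injOn_appendLeft a _ _), finsum_mem_image (injOn_appendRight _ b _)]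
    congr 1
    · exact finsum_mem_congr rfl fun p _ => by rw [rowInv_appendLeft _ h]
    · exact finsum_mem_congr rfl fun p hp => by rw [rowInv_appendRight hp (by omega)]
  · rw [rowInvSum, rowInvSum, twoRowFillingSet_succ_succ,
      finsum_mem_union (disjoint_image_append b b) ((finite_twoRowFillingSet _ _).image _)
        ((finite_twoRowFillingSet _ _).image _),
      finsum_mem_image (injOn_appendLeft b _ _), finsum_mem_image (injOn_appendRight _ b _),
      add_mul, one_mul, add_comm]
    congr 1
    · exact finsum_mem_congr rfl fun p hp => by rw [rowInv_appendRight hp le_rfl]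
    -- Reindexing by the row swap turns the sum over shape (b+1, b) into one over (b, b+1), where
    -- the maximum is appended to the first row.
    · rw [mul_finsum_mem' _ _ (finite_twoRowFillingSet _ _), ← swap_image_twoRowFillingSet b (b + 1),
        finsum_mem_image Prod.swap_injective.injOn]
      exact finsum_mem_congr rfl fun p hp => by rw [rowInv_appendLeft_diag hp, pow_succ']

/-! ### From row-standard fillings to pairs of rows -/

namespace RowStandardFilling

variable {n : ℕ}

/-- The two rows of a filling of the shape `(n, n)`. -/
def rows (τ : RowStandardFilling (twoRowShape n)) : (ℕ → ℕ) × (ℕ → ℕ) := (τ.entry 0, τ.entry 1)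

theorem card_twoRowShape (n : ℕ) : (twoRowShape n).card = n + n := by
  have h : (twoRowShape n).cells = Finset.range 2 ×ˢ Finset.range n := by
    ext ⟨i, j⟩
    rw [YoungDiagram.mem_cells, mem_twoRowShape, Finset.mem_product, Finset.mem_range,
      Finset.mem_range]
  rw [YoungDiagram.card, h, Finset.card_product, Finset.card_range, Finset.card_range, two_mul]

theorem NoRepeats.isTwoRowFilling {τ : RowStandardFilling (twoRowShape n)} (h : τ.NoRepeats) :
    IsTwoRowFilling n n (τ.entry 0) (τ.entry 1) where
  left_zero j hj := τ.zeros fun hm => absurd (mem_twoRowShape.1 hm).2 (by omega)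
  right_zero j hj := τ.zeros fun hm => absurd (mem_twoRowShape.1 hm).2 (by omega)
  left_mem j hj := ⟨τ.pos (mem_twoRowShape.2 ⟨by omega, hj⟩),
    card_twoRowShape n ▸ τ.entry_le_card 0 j⟩
  right_mem j hj := ⟨τ.pos (mem_twoRowShape.2 ⟨by omega, hj⟩),
    card_twoRowShape n ▸ τ.entry_le_card 1 j⟩
  left_lt i j hij hj := τ.row_strict hij (mem_twoRowShape.2 ⟨by omega, hj⟩)
  right_lt i j hij hj := τ.row_strict hij (mem_twoRowShape.2 ⟨by omega, hj⟩)
  ne i j hi hj hij := by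
    have := @h (0, i) (mem_twoRowShape.2 ⟨by omega, hi⟩) (1, j)
      (mem_twoRowShape.2 ⟨by omega, hj⟩) hij
    simp at this

/-- The filling of the shape `(n, n)` with given rows. -/
def ofRows {f g : ℕ → ℕ} (h : IsTwoRowFilling n n f g) : RowStandardFilling (twoRowShape n) where
  entry i j := if i = 0 then f j else if i = 1 then g j else 0
  zeros {i j} hm := by
    have := h.left_zero j
    have := h.right_zero j
    rw [mem_twoRowShape] at hm
    grind
  pos {i j} hm := by
    have := h.left_mem j
    have := h.right_mem j
    rw [mem_twoRowShape] at hm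
    grind
  no_skip {i j v} hm hv hv' := by
    have h1 := h.left_mem j
    have h2 := h.right_mem j
    rw [mem_twoRowShape] at hm
    have hle : v ≤ n + n := by grind
    rcases h.exists_eq hv hle with ⟨c, hc, rfl⟩ | ⟨c, hc, rfl⟩
    · exact ⟨(0, c), mem_twoRowShape.2 ⟨by omega, hc⟩, by simp⟩
    · exact ⟨(1, c), mem_twoRowShape.2 ⟨by omega, hc⟩, by simp⟩
  row_strict {i j₁ j₂} hj hm := by
    have := h.left_lt j₁ j₂ hj
    have := h.right_lt j₁ j₂ hj
    rw [mem_twoRowShape] at hm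
    grind

theorem noRepeats_ofRows {f g : ℕ → ℕ} (h : IsTwoRowFilling n n f g) : (ofRows h).NoRepeats := by
  rintro ⟨i, j⟩ hij ⟨i', j'⟩ hij' heq
  have hf := h.injOn_left
  have hg := h.swap.injOn_left
  have hne := h.ne
  simp only [Set.InjOn, Finset.coe_range, Set.mem_Iio] at hf hg
  have h1 := mem_twoRowShape.1 hij
  have h2 := mem_twoRowShape.1 hij'
  simp only [ofRows] at heq
  grind

theorem rows_ofRows {f g : ℕ → ℕ} (h : IsTwoRowFilling n n f g) : (ofRows h).rows = (f, g) := by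
  simp [rows, ofRows]

theorem rows_injective : Function.Injective (rows (n := n)) := by
  intro τ τ' h
  ext i j
  simp only [rows, Prod.mk.injEq] at h
  by_cases hm : (i, j) ∈ twoRowShape n
  · have := (mem_twoRowShape.1 hm).1
    interval_cases i
    · rw [h.1]
    · rw [h.2]
  · rw [τ.zeros hm, τ'.zeros hm]

/-- Without repeated entries an inversion pair is determined by its column and the next one. -/
theorem NoRepeats.isInversionPair_iff {τ : RowStandardFilling (twoRowShape n)} (h : τ.NoRepeats)
    (r s c : ℕ) : τ.IsInversionPair r s c ↔ r < 2 ∧ s < 2 ∧ c < n ∧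
      τ.entry r c < τ.entry s c ∧ (c + 1 < n → τ.entry s (c + 1) < τ.entry r (c + 1)) ∧
      (c + 1 = n → s < r) := by
  simp only [IsInversionPair, mem_twoRowShape]
  constructor
  · rintro ⟨⟨hr, hc⟩, ⟨hs, -⟩, hlt, m, hm, hm'⟩
    -- An agreement in column `c + 1` would force `r = s` by injectivity, against the strict
    -- inequality in column `c`.
    have hm0 : m = 0 := by
      by_contra hne
      obtain ⟨h1, h2, h3⟩ := hm 1 le_rfl (by omega)
      have := h (mem_twoRowShape.2 h1) (mem_twoRowShape.2 h2) h3
      simp only [Prod.mk.injEq, and_true] at this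
      subst this
      exact lt_irrefl _ hlt
    subst hm0
    simp only [zero_add] at hm'
    refine ⟨hr, hs, hc, hlt, fun hc1 => ?_, fun hc1 => ?_⟩
    · rcases hm' with ⟨h1, -⟩ | h1
      · omega
      · exact h1.2.2
    · rcases hm' with h1 | h1
      · exact h1.2
      · omega
  · rintro ⟨hr, hs, hc, hlt, h1, h2⟩
    refine ⟨⟨hr, hc⟩, ⟨hs, hc⟩, hlt, 0, fun k hk hk' => by omega, ?_⟩
    rcases Nat.lt_or_ge (c + 1) n with hcn | hcn
    · exact Or.inr ⟨⟨hr, hcn⟩, ⟨hs, hcn⟩, h1 hcn⟩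
    · exact Or.inl ⟨by omega, h2 (by omega)⟩

theorem NoRepeats.inv_eq_rowInv {τ : RowStandardFilling (twoRowShape n)} (h : τ.NoRepeats) :
    τ.inv = rowInv n τ.rows := by
  have hne := h.isTwoRowFilling.ne
  rw [inv, rowInv, ← Set.ncard_coe_finset]
  refine Set.ncard_congr (fun p _ => p.2.2) ?_ ?_ ?_
  · rintro ⟨r, s, c⟩ hp
    obtain ⟨hr, hs, hc, h1, h2, h3⟩ := (h.isInversionPair_iff r s c).1 hp
    have := hne (c + 1) (c + 1)
    rw [Finset.mem_coe, Finset.mem_filter, Finset.mem_range]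
    refine ⟨hc, ?_⟩
    simp only [rows]
    interval_cases r <;> interval_cases s <;> grind
  · rintro ⟨r, s, c⟩ ⟨r', s', c'⟩ hp hp' hcc
    obtain ⟨hr, hs, hc, h1, -⟩ := (h.isInversionPair_iff r s c).1 hp
    obtain ⟨hr', hs', hc', h1', -⟩ := (h.isInversionPair_iff r' s' c').1 hp'
    simp only at hcc
    subst hcc
    interval_cases r <;> interval_cases s <;> interval_cases r' <;> interval_cases s' <;> grind
  · intro c hc
    rw [Finset.mem_coe, Finset.mem_filter, Finset.mem_range] at hc
    simp only [rows] at hc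
    have h1 := hne c c hc.1 hc.1
    have h2 := hne (c + 1) (c + 1)
    -- The pair must list the row of the smaller entry first, so the order of column `c` selects the
    -- preimage.
    by_cases hlt : τ.entry 0 c < τ.entry 1 c
    · refine ⟨(0, 1, c), (h.isInversionPair_iff 0 1 c).2 ?_, rfl⟩
      grind
    · refine ⟨(1, 0, c), (h.isInversionPair_iff 1 0 c).2 ?_, rfl⟩
      grind

theorem ncard_invertedStandardTableaux (n k : ℕ) :
    (invertedStandardTableaux k (twoRowShape n)).ncard =
      ((finite_twoRowFillingSet n n).toFinset.filter fun p => rowInv n p = k).card := by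
  rw [← Set.ncard_coe_finset]
  refine Set.ncard_congr (fun τ _ => τ.rows) ?_ (fun τ τ' _ _ h => rows_injective h) ?_
  · rintro τ ⟨hτ, hk⟩
    simp only [Finset.coe_filter, Set.Finite.mem_toFinset, Set.mem_ofPred_eq]
    exact ⟨hτ.isTwoRowFilling, hτ.inv_eq_rowInv ▸ hk⟩
  · rintro ⟨f, g⟩ hp
    simp only [Finset.coe_filter, Set.Finite.mem_toFinset, Set.mem_ofPred_eq] at hp
    obtain ⟨hp, hk⟩ := hp
    have h : IsTwoRowFilling n n f g := hp
    refine ⟨ofRows h, ⟨noRepeats_ofRows h, ?_⟩, rows_ofRows h⟩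
    rw [(noRepeats_ofRows h).inv_eq_rowInv, rows_ofRows, hk]

theorem mk_ncard_invertedStandardTableaux (n : ℕ) (hn : 1 ≤ n) :
    (PowerSeries.mk fun k : ℕ => ((invertedStandardTableaux k (twoRowShape n)).ncard : ℚ)) =
      ∑ i ∈ Finset.Icc 1 n,
        ballotNumber (n - 1) (n - i) • (1 + PowerSeries.X : PowerSeries ℚ) ^ i := by
  simp only [ncard_invertedStandardTableaux]
  rw [PowerSeries.mk_card_filter, ← finsum_mem_eq_finite_toFinset_sum,
    ← sum_range_ballotNumber_pred _ n hn]
  obtain ⟨m, rfl⟩ : ∃ m, n = m + 1 := ⟨n - 1, by omega⟩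
  exact rowInvSum_eq PowerSeries.X m (m + 1) le_rfl

end RowStandardFilling

theorem mainTheorem7 (n : ℕ) (hn : 1 ≤ n) :
    (PowerSeries.mk fun k : ℕ => ((invertedStandardTableaux k (twoRowShape n)).ncard : ℚ)) =
      ∑ i ∈ Finset.Icc 1 n, ballotNumber (n - 1) (n - i) • (1 + PowerSeries.X : PowerSeries ℚ) ^ i ∧
    (PowerSeries.mk fun k : ℕ => ((invertedStandardTableaux k (twoRowShape n)).ncard : ℚ)) =
      ∑ i ∈ Finset.Icc 1 n,
        ((i : ℚ) / n * (2 * n - i - 1).choose (n - i)) •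
          (1 + PowerSeries.X : PowerSeries ℚ) ^ i ∧
    ∀ i ≤ n, ((dyckPathsWithReturns n i).ncard : ℚ) = ballotNumber (n - 1) (n - i) := by
  have h := RowStandardFilling.mk_ncard_invertedStandardTableaux n hn
  refine ⟨h, h.trans (Finset.sum_congr rfl fun i hi => ?_),
    fun i hi => ncard_dyckPathsWithReturns n i hn hi⟩
  rw [Finset.mem_Icc] at hi
  rw [ballotNumber_pred_sub n i hi.1 hi.2]
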